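/- **Theorem 4.1.** Let $N$ be a dimension, let $q>1$, $\delta>1$, $\eta_+\ge 0$, $\eta_-\ge 0$, $M>0$, and let $p$ be the conjugate exponent of $q$, i.e. $\frac1p+\frac1q=1$. Then there is $\theta>p$, depending only on $q,\delta,N,\eta_\pm,M$, and for every $\tau>0$ there is a constant $C(\tau)>0$, depending only on $\tau$ and on $q,\delta,N,\eta_\pm,M$, such that the following holds. Let $T\ge\tau$, let $H:\mathbb R^N\times(0,T)\times\mathbb R^N\to\mathbb R$ be continuous (not necessarily convex in its last variable) with $$\frac1\delta|z|^q-\eta_-\le H(x,t,z)\le\delta|z|^q+\eta_+\qquad\forall (x,t,z)\in\mathbb R^N\times(0,T)\times\mathbb R^N,$$ and let $u\in C(\mathbb R^N\times[0,T])$ be a viscosity solution of $$u_t+H(x,t,Du)=0\qquad\text{in }\mathbb R^N\times(0,T)$$ with $|u|\le M$ on $\mathbb R^N\times(0,T)$. Then $$|u(x,t)-u(y,s)|\le C(\tau)\left[|x-y|^{\frac{\theta-p}{\theta-1}}+|t-s|^{\frac{\theta-p}{\theta}}\right]\qquad\forall (x,t),(y,s)\in\mathbb R^N\times[\tau,T].$$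 In particular, $\theta$ and $C(\tau)$ do not depend on the modulus of continuity of $H$. Here, $u$ is a viscosity solution if, for every $\varphi\in C^1(\mathbb R^N\times(0,T))$, one has $\varphi_t+H(x,t,D\varphi)\le0$ at each point $(x,t)\in\mathbb R^N\times(0,T)$ where $u-\varphi$ has a local maximum, and $\varphi_t+H(x,t,D\varphi)\ge0$ at each point $(x,t)\in\mathbb R^N\times(0,T)$ where $u-\varphi$ has a local minimum. -/

import Mathlib

/-- `u` is a viscosity subsolution of `u_t + H(x,t,Du) = 0` in the open set `Ω ⊆ ℝᴺ × ℝ`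
(to be used for continuous `u`): at every local maximum point in `Ω` of `u - φ`, with `φ` of
class `C¹` in `Ω`, one has `φ_t + H(x,t,Dφ) ≤ 0`. -/
def IsViscositySubsolution {N : ℕ} (Ω : Set (EuclideanSpace ℝ (Fin N) × ℝ))
    (H : EuclideanSpace ℝ (Fin N) → ℝ → EuclideanSpace ℝ (Fin N) → ℝ)
    (u : EuclideanSpace ℝ (Fin N) → ℝ → ℝ) : Prop :=
  ∀ φ : EuclideanSpace ℝ (Fin N) × ℝ → ℝ, ContDiffOn ℝ 1 φ Ω →
    ∀ (x : EuclideanSpace ℝ (Fin N)) (t : ℝ), (x, t) ∈ Ω →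
      IsLocalMax (fun z : EuclideanSpace ℝ (Fin N) × ℝ => u z.1 z.2 - φ z) (x, t) →
        deriv (fun s => φ (x, s)) t + H x t (gradient (fun y => φ (y, t)) x) ≤ 0

/-- `u` is a viscosity supersolution of `u_t + H(x,t,Du) = 0` in the open set `Ω ⊆ ℝᴺ × ℝ`
(to be used for continuous `u`): at every local minimum point in `Ω` of `u - φ`, with `φ` of
class `C¹` in `Ω`, one has `φ_t + H(x,t,Dφ) ≥ 0`. -/
def IsViscositySupersolution {N : ℕ} (Ω : Set (EuclideanSpace ℝ (Fin N) × ℝ))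
    (H : EuclideanSpace ℝ (Fin N) → ℝ → EuclideanSpace ℝ (Fin N) → ℝ)
    (u : EuclideanSpace ℝ (Fin N) → ℝ → ℝ) : Prop :=
  ∀ φ : EuclideanSpace ℝ (Fin N) × ℝ → ℝ, ContDiffOn ℝ 1 φ Ω →
    ∀ (x : EuclideanSpace ℝ (Fin N)) (t : ℝ), (x, t) ∈ Ω →
      IsLocalMin (fun z : EuclideanSpace ℝ (Fin N) × ℝ => u z.1 z.2 - φ z) (x, t) →
        0 ≤ deriv (fun s => φ (x, s)) t + H x t (gradient (fun y => φ (y, t)) x)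

/-- `u` is a viscosity solution of `u_t + H(x,t,Du) = 0` in the open set `Ω ⊆ ℝᴺ × ℝ`. -/
def IsViscositySolution {N : ℕ} (Ω : Set (EuclideanSpace ℝ (Fin N) × ℝ))
    (H : EuclideanSpace ℝ (Fin N) → ℝ → EuclideanSpace ℝ (Fin N) → ℝ)
    (u : EuclideanSpace ℝ (Fin N) → ℝ → ℝ) : Prop :=
  IsViscositySubsolution Ω H u ∧ IsViscositySupersolution Ω H u

/-!
The proof is an improvement-of-oscillation argument that uses the equation only through two
one-sided Hopf–Lax estimates, in which the constants need not match.

The bounds on `H` make `u` a subsolution of `u_t + |Du|^q / δ = η` and a supersolution of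
`u_t + δ |Du|^q = -η`. Comparison with explicit radial barriers `f(t) + g(t) ‖y - x₀‖ᵖ` gives, for
`s < t`,

* `u(x,t) ≤ u(y,s) + c₁ ‖x - y‖ᵖ / (t - s)ᵖ⁻¹ + η (t - s)` for every `y`
  (`IsViscositySubsolution.le_hopfLax`);
* `u(x,t) ≥ inf_y (u(y,s) + c₂ ‖x - y‖ᵖ / (t - s)ᵖ⁻¹) - η (t - s)`
  (`IsViscositySupersolution.hopfLax_le`).

Consider backward cylinders of radius `r` and height `h` on which `u` oscillates by at most `ω`, with
`rᵖ` a fixed multiple of `ω hᵖ⁻¹`, so that the cost of crossing the cylinder is comparable to `ω`.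
If `u` is below its middle value at some point near the center of the bottom of the cylinder, the
first estimate lowers the supremum of `u` on a smaller cylinder. Otherwise staying near the center
is not profitable in the second estimate, and moving away costs a fixed fraction of `ω`, so the
infimum goes up. The infimum over `y` involves points outside the cylinder; there the oscillation
bound, assumed for all centers simultaneously, gives at most linear growth
(`OscBound.lower_bound`), which the cost beats because `p > 1`. Hence the oscillation drops by a
fixed factor when the cylinder shrinks by fixed ratios (`OscBound.step`), and iteration
(`OscBound.iterate`) yields a Hölder bound. Every sufficiently small pair of exponents is
admissible, and both `(θ - p) / (θ - 1)` and `(θ - p) / θ` tend to `0` as `θ ↓ p`, which gives `θ`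
(`exists_theta`) independently of `τ`.
-/

open Filter Topology Set

/-! ### Viscosity subsolutions and barriers -/

/-- The reflection `u ↦ -u` turns supersolutions for `H` into subsolutions for
`(x, t, z) ↦ -H(x, t, -z)`, so that comparison arguments are needed for subsolutions only. -/
theorem IsViscositySupersolution.neg {N : ℕ} {Ω : Set (EuclideanSpace ℝ (Fin N) × ℝ)}
    {H : EuclideanSpace ℝ (Fin N) → ℝ → EuclideanSpace ℝ (Fin N) → ℝ}
    {u : EuclideanSpace ℝ (Fin N) → ℝ → ℝ} (hu : IsViscositySupersolution Ω H u) :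
    IsViscositySubsolution Ω (fun x t z => -H x t (-z)) (fun x t => -u x t) := by
  intro φ hφ x t hxt hmax
  have h := hu (fun z => -φ z) hφ.neg x t hxt (by
    have e : (fun z : EuclideanSpace ℝ (Fin N) × ℝ => u z.1 z.2 - -φ z) =
        fun z => -(-u z.1 z.2 - φ z) := by ext; ring
    rw [e]
    exact hmax.neg)
  have h1 : gradient (fun y => -φ (y, t)) x = -gradient (fun y => φ (y, t)) x := by
    simp only [gradient, fderiv_fun_neg, map_neg]
  rw [h1, deriv.fun_neg] at h
  simp only
  linarith

/-- It suffices for a test function to be `C¹` near the touching point. -/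
theorem IsViscositySubsolution.of_contDiffAt {N : ℕ} {Ω : Set (EuclideanSpace ℝ (Fin N) × ℝ)}
    {H : EuclideanSpace ℝ (Fin N) → ℝ → EuclideanSpace ℝ (Fin N) → ℝ}
    {u : EuclideanSpace ℝ (Fin N) → ℝ → ℝ} (hu : IsViscositySubsolution Ω H u)
    {φ : EuclideanSpace ℝ (Fin N) × ℝ → ℝ} {x : EuclideanSpace ℝ (Fin N)} {t : ℝ}
    (hxt : (x, t) ∈ Ω) (hφ : ContDiffAt ℝ 1 φ (x, t))
    (hmax : IsLocalMax (fun z : EuclideanSpace ℝ (Fin N) × ℝ => u z.1 z.2 - φ z) (x, t)) :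
    deriv (fun s => φ (x, s)) t + H x t (gradient (fun y => φ (y, t)) x) ≤ 0 := by
  obtain ⟨ε, hε, hball⟩ := Metric.eventually_nhds_iff_ball.1 (hφ.eventually (by simp))
  -- multiply by a cut-off function that is `1` near the touching point
  let f : ContDiffBump (x, t) := ⟨ε / 4, ε / 2, by positivity, by linarith⟩
  have hf : (fun z => f z * φ z) =ᶠ[𝓝 (x, t)] φ := by
    filter_upwards [f.eventuallyEq_one] with z hz
    simp [hz]
  have hsm : ContDiff ℝ 1 (fun z => f z * φ z) := by
    rw [contDiff_iff_contDiffAt]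
    intro z
    by_cases hz : z ∈ Metric.ball (x, t) ε
    · exact f.contDiffAt.mul (hball z hz)
    · have : (fun z => f z * φ z) =ᶠ[𝓝 z] fun _ => 0 := by
        have : z ∈ (Metric.closedBall (x, t) (ε / 2))ᶜ := by
          simp only [Metric.mem_ball, mem_compl_iff, Metric.mem_closedBall, not_lt, not_le] at *
          linarith
        filter_upwards [Metric.isClosed_closedBall.isOpen_compl.mem_nhds this] with w hw
        rw [f.zero_of_le_dist, zero_mul]
        simp only [mem_compl_iff, Metric.mem_closedBall, not_le] at hw
        exact hw.le
      exact contDiffAt_const.congr_of_eventuallyEq this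
  have h := hu _ hsm.contDiffOn x t hxt (hmax.congr (by
    filter_upwards [hf] with z hz
    rw [hz]))
  have h1 : (fun s => f (x, s) * φ (x, s)) =ᶠ[𝓝 t] fun s => φ (x, s) :=
    (Continuous.prodMk_right x).continuousAt.eventually hf
  have h2 : (fun y => f (y, t) * φ (y, t)) =ᶠ[𝓝 x] fun y => φ (y, t) :=
    (Continuous.prodMk_left t).continuousAt.eventually hf
  rwa [h1.deriv_eq, h2.gradient_eq] at h

/-- Test functions `f(t) + g(t) ‖y - x₀‖ᵖ`: with `p` conjugate to `q`, both the time derivative and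
the `q`-th power of the spatial gradient are multiples of `‖y - x₀‖ᵖ`. -/
theorem IsViscositySubsolution.radial_test {N : ℕ} {Ω : Set (EuclideanSpace ℝ (Fin N) × ℝ)}
    {H : EuclideanSpace ℝ (Fin N) → ℝ → EuclideanSpace ℝ (Fin N) → ℝ}
    {u : EuclideanSpace ℝ (Fin N) → ℝ → ℝ} (hu : IsViscositySubsolution Ω H u)
    {p q κ η : ℝ} (hpq : p.HolderConjugate q)
    (hH : ∀ x t z, (x, t) ∈ Ω → κ * ‖z‖ ^ q - η ≤ H x t z)
    {f g : ℝ → ℝ} {x₀ y : EuclideanSpace ℝ (Fin N)} {t f' g' : ℝ} (hyt : (y, t) ∈ Ω)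
    (hf : ContDiffAt ℝ 1 f t) (hg : ContDiffAt ℝ 1 g t)
    (hf' : HasDerivAt f f' t) (hg' : HasDerivAt g g' t) (hg0 : 0 ≤ g t)
    (hmax : IsLocalMax (fun z : EuclideanSpace ℝ (Fin N) × ℝ =>
      u z.1 z.2 - (f z.2 + g z.2 * ‖z.1 - x₀‖ ^ p)) (y, t)) :
    f' + (g' + κ * (p * g t) ^ q) * ‖y - x₀‖ ^ p ≤ η := by
  have hp := hpq.lt
  have hφ : ContDiffAt ℝ 1 (fun z : EuclideanSpace ℝ (Fin N) × ℝ =>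
      f z.2 + g z.2 * ‖z.1 - x₀‖ ^ p) (y, t) := by
    have hn : ContDiffAt ℝ 1 (fun z : EuclideanSpace ℝ (Fin N) × ℝ => ‖z.1 - x₀‖ ^ p) (y, t) :=
      ((contDiff_fst.sub contDiff_const).norm_rpow hp).contDiffAt
    exact (ContDiffAt.comp (y, t) hf contDiffAt_snd).add
      ((ContDiffAt.comp (y, t) hg contDiffAt_snd).mul hn)
  have h := hu.of_contDiffAt hyt hφ hmax
  have hd : deriv (fun s => f s + g s * ‖y - x₀‖ ^ p) t = f' + g' * ‖y - x₀‖ ^ p :=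
    (hf'.add (hg'.mul_const _)).deriv
  have hgrad : ‖gradient (fun y => f t + g t * ‖y - x₀‖ ^ p) y‖ = p * g t * ‖y - x₀‖ ^ (p - 1) := by
    have h1 : HasFDerivAt (fun y => f t + g t * ‖y - x₀‖ ^ p)
        (g t • (fderiv ℝ (fun x : EuclideanSpace ℝ (Fin N) => ‖x‖ ^ p) (y - x₀))) y := by
      have h2 := ((contDiff_norm_rpow (E := EuclideanSpace ℝ (Fin N)) hp).differentiable
        one_ne_zero (y - x₀)).hasFDerivAt
      have h3 : HasFDerivAt (fun y => ‖y - x₀‖ ^ p)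
        (fderiv ℝ (fun x : EuclideanSpace ℝ (Fin N) => ‖x‖ ^ p) (y - x₀)) y := by
        exact h2.comp y ((hasFDerivAt_id y).sub_const x₀)
      exact (h3.const_mul (g t)).const_add (f t)
    rw [gradient, h1.fderiv, LinearIsometryEquiv.norm_map, norm_smul,
      norm_fderiv_norm_id_rpow _ hp, Real.norm_of_nonneg hg0]
    ring
  have hb := hH y t (gradient (fun y => f t + g t * ‖y - x₀‖ ^ p) y) hyt
  rw [hgrad, Real.mul_rpow (mul_nonneg hpq.nonneg hg0) (by positivity),
    ← Real.rpow_mul (norm_nonneg _), hpq.sub_one_mul_conj] at hb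
  simp only [hd] at h
  nlinarith

/-- Comparison principle on `ℝᴺ × [s, t₁)`: if `v` lies below the barrier `w` initially and outside
a bounded set, then it can only exceed `w` if it touches, from below and after adding a constant,
one of the penalized barriers `w + γ / (t₁ - t)`. -/
theorem le_of_not_isLocalMax {X : Type*} [NormedAddCommGroup X] [ProperSpace X]
    {v w : X → ℝ → ℝ} {s t₁ R : ℝ}
    (hv : ContinuousOn (fun z : X × ℝ => v z.1 z.2) (univ ×ˢ Icc s t₁))
    (hw : ContinuousOn (fun z : X × ℝ => w z.1 z.2) (univ ×ˢ Icc s t₁))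
    (hR : ∀ y, ∀ t ∈ Icc s t₁, R ≤ ‖y‖ → v y t ≤ w y t)
    (hs : ∀ y, v y s ≤ w y s)
    (hmax : ∀ γ > 0, ∀ y, ∀ t ∈ Ioo s t₁,
      ¬ IsLocalMax (fun z : X × ℝ => v z.1 z.2 - (w z.1 z.2 + γ / (t₁ - z.2))) (y, t))
    (y : X) (t : ℝ) (ht : t ∈ Ico s t₁) : v y t ≤ w y t := by
  by_contra! hlt
  obtain ⟨hst, htt⟩ := ht
  have hyR : ‖y‖ < R := by
    by_contra! h
    exact hlt.not_ge (hR y t ⟨hst, htt.le⟩ h)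
  set D := v y t - w y t with hD
  have hD0 : 0 < D := sub_pos.2 hlt
  set γ := D * (t₁ - t) / 2 with hγ
  have htt' : 0 < t₁ - t := sub_pos.2 htt
  have hγ0 : 0 < γ := by positivity
  have hK : IsCompact (Metric.closedBall (0 : X) R ×ˢ Icc s t₁) :=
    (isCompact_closedBall _ _).prod isCompact_Icc
  have hcont : ContinuousOn (fun z : X × ℝ => v z.1 z.2 - w z.1 z.2) (univ ×ˢ Icc s t₁) := hv.sub hw
  obtain ⟨B, hB⟩ := hK.bddAbove_image (hcont.mono (prod_mono (subset_univ _) subset_rfl))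
  have hB' : ∀ x r, ‖x‖ ≤ R → r ∈ Icc s t₁ → v x r - w x r ≤ B := fun x r hx hr =>
    hB ⟨(x, r), ⟨by simpa using hx, hr⟩, rfl⟩
  have hDB : D ≤ B := hB' y t hyR.le ⟨hst, htt.le⟩
  have hB0 : 0 < B := hD0.trans_le hDB
  -- at the time `t₂` the penalization dominates `v - w` on the ball of radius `R`
  set t₂ := t₁ - γ / B with ht₂
  have htt₂ : t < t₂ := by
    have : γ / B < t₁ - t := by
      rw [div_lt_iff₀ hB0, hγ]
      nlinarith
    rw [ht₂]; linarith
  have ht₂₁ : t₂ < t₁ := by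
    have : 0 < γ / B := by positivity
    rw [ht₂]; linarith
  have hK₂ : IsCompact (Metric.closedBall (0 : X) R ×ˢ Icc s t₂) :=
    (isCompact_closedBall _ _).prod isCompact_Icc
  have hψ : ContinuousOn (fun z : X × ℝ => v z.1 z.2 - (w z.1 z.2 + γ / (t₁ - z.2)))
      (Metric.closedBall (0 : X) R ×ˢ Icc s t₂) := by
    have hsub : Metric.closedBall (0 : X) R ×ˢ Icc s t₂ ⊆ univ ×ˢ Icc s t₁ :=
      prod_mono (subset_univ _) (Icc_subset_Icc_right ht₂₁.le)
    refine (hv.mono hsub).sub ((hw.mono hsub).add (ContinuousOn.div continuousOn_const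
      (continuousOn_const.sub continuousOn_snd) ?_))
    rintro ⟨x, r⟩ ⟨-, hr⟩
    have := hr.2
    simp only at this ⊢
    linarith
  obtain ⟨⟨x, r⟩, ⟨hx, hr⟩, hxr⟩ := hK₂.exists_isMaxOn
    ⟨(y, t), by simpa using hyR.le, hst, htt₂.le⟩ hψ
  have hpos : 0 < v x r - (w x r + γ / (t₁ - r)) := by
    have h1 := hxr (a := (y, t)) ⟨by simpa using hyR.le, hst, htt₂.le⟩
    have h2 : γ / (t₁ - t) = D / 2 := by rw [hγ]; field_simp
    simp only [mem_ofPred_eq, h2] at h1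
    linarith
  simp only [mem_closedBall_zero_iff] at hx hr
  have hr1 : r < t₁ := hr.2.trans_lt ht₂₁
  have hpen : 0 < γ / (t₁ - r) := div_pos hγ0 (sub_pos.2 hr1)
  have hxR : ‖x‖ < R := by
    by_contra! h
    have := hR x r ⟨hr.1, hr1.le⟩ h
    linarith
  have hrs : s < r := by
    refine lt_of_le_of_ne hr.1 fun h => ?_
    have := hs x
    rw [h] at this
    linarith
  have hrt : r < t₂ := by
    refine lt_of_le_of_ne hr.2 fun h => ?_
    have h1 := hB' x r hx ⟨hr.1, hr1.le⟩
    have h2 : γ / (t₁ - r) = B := by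
      rw [h, ht₂, sub_sub_cancel]; field_simp
    linarith
  refine hmax γ hγ0 x r ⟨hrs, hr1⟩ (hxr.isLocalMax ?_)
  exact prod_mem_nhds (mem_of_superset (Metric.isOpen_ball.mem_nhds (by simpa using hxR))
    Metric.ball_subset_closedBall) (Icc_mem_nhds hrs hrt)

/-- Comparison of a bounded subsolution with a radial barrier `b + L (t - s) + g(t) ‖y - x₀‖ᵖ`. -/
theorem IsViscositySubsolution.le_radial_barrier {N : ℕ} {T : ℝ}
    {H : EuclideanSpace ℝ (Fin N) → ℝ → EuclideanSpace ℝ (Fin N) → ℝ}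
    {u : EuclideanSpace ℝ (Fin N) → ℝ → ℝ}
    (hu : IsViscositySubsolution (univ ×ˢ Ioo 0 T) H u)
    {p q κ η M : ℝ} (hpq : p.HolderConjugate q)
    (hH : ∀ x, ∀ t ∈ Ioo 0 T, ∀ z, κ * ‖z‖ ^ q - η ≤ H x t z)
    (huc : ContinuousOn (fun w : EuclideanSpace ℝ (Fin N) × ℝ => u w.1 w.2) (univ ×ˢ Ioo 0 T))
    (hM : ∀ x, ∀ t ∈ Ioo 0 T, u x t ≤ M)
    {s t₁ b L g₀ : ℝ} {g : ℝ → ℝ} {x₀ : EuclideanSpace ℝ (Fin N)} (hs : 0 < s) (ht₁ : t₁ < T)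
    (hL : η < L) (hg₀ : 0 < g₀) (hg : ∀ t ∈ Icc s t₁, g₀ ≤ g t)
    (hgc : ∀ t ∈ Icc s t₁, ContDiffAt ℝ 1 g t)
    (hode : ∀ t ∈ Ioo s t₁, 0 ≤ deriv g t + κ * (p * g t) ^ q)
    (hini : ∀ y, u y s ≤ b + g s * ‖y - x₀‖ ^ p)
    (y : EuclideanSpace ℝ (Fin N)) (t : ℝ) (ht : t ∈ Ico s t₁) :
    u y t ≤ b + L * (t - s) + g t * ‖y - x₀‖ ^ p := by
  have hp := hpq.lt
  have hp0 := hpq.pos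
  have hI : Icc s t₁ ⊆ Ioo 0 T := fun r hr => ⟨hs.trans_le hr.1, hr.2.trans_lt ht₁⟩
  have hgcont : ContinuousOn g (Icc s t₁) := fun t ht => (hgc t ht).continuousAt.continuousWithinAt
  -- outside a large ball the barrier exceeds the bound `M`
  obtain ⟨A, hA0, hA⟩ : ∃ A : ℝ, 0 ≤ A ∧ ∀ a, A ≤ a → M + |b| + |L| * (t₁ - s) ≤ g₀ * a ^ p := by
    have h1 : Tendsto (fun a : ℝ => g₀ * a ^ p) atTop atTop :=
      (tendsto_rpow_atTop hp0).const_mul_atTop hg₀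
    obtain ⟨A, hA⟩ := eventually_atTop.1 (h1.eventually_ge_atTop (M + |b| + |L| * (t₁ - s)))
    exact ⟨max A 0, le_max_right _ _, fun a ha => hA a ((le_max_left _ _).trans ha)⟩
  refine le_of_not_isLocalMax (v := u) (w := fun y t => b + L * (t - s) + g t * ‖y - x₀‖ ^ p)
    (R := A + ‖x₀‖) (huc.mono (prod_mono subset_rfl hI)) ?_ ?_ ?_ ?_ y t ht
  · refine ContinuousOn.add (Continuous.continuousOn (by fun_prop)) (ContinuousOn.mul
      (hgcont.comp continuousOn_snd fun z hz => hz.2) (Continuous.continuousOn ?_))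
    exact (continuous_fst.sub continuous_const).norm.rpow_const fun _ => Or.inr hp0.le
  · intro y t ht hy
    have h1 : A ≤ ‖y - x₀‖ := by linarith [norm_sub_norm_le y x₀]
    have h2 := hA _ h1
    have h3 := mul_le_mul_of_nonneg_right (hg t ht) (Real.rpow_nonneg (norm_nonneg (y - x₀)) p)
    have h4 : -(|L| * (t₁ - s)) ≤ L * (t - s) := by
      have : |L| * (t - s) ≤ |L| * (t₁ - s) :=
        mul_le_mul_of_nonneg_left (by linarith [ht.2]) (abs_nonneg _)
      nlinarith [neg_abs_le L, ht.1]
    linarith [hM y t (hI ht), neg_abs_le b]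
  · intro y
    simpa using hini y
  · intro γ hγ y t ht hmax
    have htI : t ∈ Icc s t₁ := Ioo_subset_Icc_self ht
    have hne : t₁ - t ≠ 0 := by linarith [ht.2]
    have hpen : HasDerivAt (fun r => b + L * (r - s) + γ / (t₁ - r)) (L + γ / (t₁ - t) ^ 2) t := by
      have h1 : HasDerivAt (fun r => b + L * (r - s)) L t := by
        simpa using (((hasDerivAt_id t).sub_const s).const_mul L).const_add b
      have h2 : HasDerivAt (fun r => γ / (t₁ - r)) (γ / (t₁ - t) ^ 2) t := by
        have := (hasDerivAt_const t γ).fun_div ((hasDerivAt_id t).const_sub t₁) hne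
        simpa using this
      exact h1.add h2
    have hpc : ContDiffAt ℝ 1 (fun r => b + L * (r - s) + γ / (t₁ - r)) t := by
      refine ContDiffAt.add (by fun_prop) (ContDiffAt.div contDiffAt_const (by fun_prop) hne)
    have h := hu.radial_test hpq (κ := κ) (η := η) (fun x r z hxr => hH x r hxr.2 z)
      (x₀ := x₀) (y := y) (t := t) ⟨mem_univ _, hI htI⟩ hpc (hgc t htI) hpen
      ((hgc t htI).differentiableAt one_ne_zero).hasDerivAt (hg₀.le.trans (hg t htI))
      (by convert hmax using 3; ring)
    have h1 := mul_nonneg (hode t ht) (Real.rpow_nonneg (norm_nonneg (y - x₀)) p)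
    have h2 : 0 < γ / (t₁ - t) ^ 2 := by positivity
    linarith

/-! ### One-sided Hopf–Lax estimates -/

/-- For `u ≤ M` with `u_t + κ|Du|^q ≤ η`: forward propagation of upper bounds from a point. -/
theorem IsViscositySubsolution.le_hopfLax {N : ℕ} {T : ℝ}
    {H : EuclideanSpace ℝ (Fin N) → ℝ → EuclideanSpace ℝ (Fin N) → ℝ}
    {u : EuclideanSpace ℝ (Fin N) → ℝ → ℝ}
    (hu : IsViscositySubsolution (univ ×ˢ Ioo 0 T) H u)
    {p q κ η M c : ℝ} (hpq : p.HolderConjugate q)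
    (hH : ∀ x, ∀ t ∈ Ioo 0 T, ∀ z, κ * ‖z‖ ^ q - η ≤ H x t z)
    (huc : ContinuousOn (fun w : EuclideanSpace ℝ (Fin N) × ℝ => u w.1 w.2) (univ ×ˢ Ioo 0 T))
    (hM : ∀ x, ∀ t ∈ Ioo 0 T, u x t ≤ M)
    (hc : 0 < c) (hcκ : (p - 1) * c ≤ κ * (p * c) ^ q)
    {s t : ℝ} (hs : 0 < s) (hst : s < t) (htT : t < T) (x y : EuclideanSpace ℝ (Fin N)) :
    u x t ≤ u y s + c * ‖x - y‖ ^ p / (t - s) ^ (p - 1) + η * (t - s) := by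
  have hp := hpq.lt
  have hp0 := hpq.pos
  have hp1 : 0 < p - 1 := sub_pos.2 hp
  have key : ∀ ε > 0, u x t ≤
      u y s + c * ‖x - y‖ ^ p / (t - s) ^ (p - 1) + η * (t - s) + ε * (1 + (t - s)) := by
    intro ε hε
    obtain ⟨t₁, htt₁, ht₁T⟩ := exists_between htT
    have hcs : ContinuousAt (fun z => u z s) y := by
      have h1 : ContinuousAt (fun w : EuclideanSpace ℝ (Fin N) × ℝ => u w.1 w.2) (y, s) :=
        huc.continuousAt (prod_mem_nhds univ_mem (Ioo_mem_nhds hs (hst.trans htT)))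
      exact ContinuousAt.comp (f := fun z => (z, s)) h1 (Continuous.prodMk_left s).continuousAt
    obtain ⟨d, hd, hdy⟩ := Metric.eventually_nhds_iff.1
      (hcs.eventually (gt_mem_nhds (lt_add_of_pos_right _ hε)))
    -- shift the singularity of the Hopf–Lax kernel to an earlier time `s - σ`
    obtain ⟨σ, hσ, hσd⟩ : ∃ σ : ℝ, 0 < σ ∧ M - u y s ≤ c * σ ^ (-(p - 1)) * d ^ p := by
      have h1 : Tendsto (fun σ : ℝ => c * σ ^ (-(p - 1)) * d ^ p) (𝓝[>] 0) atTop :=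
        ((tendsto_rpow_neg_nhdsGT_zero (by linarith)).const_mul_atTop hc).atTop_mul_const
          (by positivity)
      obtain ⟨σ, h2, h3⟩ := ((h1.eventually_ge_atTop (M - u y s)).and self_mem_nhdsWithin).exists
      exact ⟨σ, h3, h2⟩
    have hg : ∀ r, s ≤ r → 0 < r - s + σ := fun r hr => by linarith
    have hpos : ∀ r, s ≤ r → 0 < c * (r - s + σ) ^ (-(p - 1)) := fun r hr =>
      mul_pos hc (Real.rpow_pos_of_pos (hg r hr) _)
    have h := hu.le_radial_barrier hpq hH huc hM (s := s) (t₁ := t₁) (b := u y s + ε) (L := η + ε)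
      (g := fun r => c * (r - s + σ) ^ (-(p - 1))) (g₀ := c * (t₁ - s + σ) ^ (-(p - 1))) (x₀ := y)
      hs ht₁T (by linarith) (hpos _ (by linarith))
      (fun r hr => mul_le_mul_of_nonneg_left (Real.rpow_le_rpow_of_nonpos (hg r hr.1)
        (by linarith [hr.2]) (by linarith)) hc.le)
      (fun r hr => contDiffAt_const.mul
        (ContDiffAt.rpow_const_of_ne (by fun_prop) (hg r hr.1).ne'))
      ?_ ?_ x t ⟨hst.le, htt₁⟩
    · have h1 : (t - s + σ) ^ (-(p - 1)) ≤ ((t - s) ^ (p - 1))⁻¹ := by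
        rw [← Real.rpow_neg (by linarith)]
        exact Real.rpow_le_rpow_of_nonpos (by linarith) (by linarith) (by linarith)
      have h2 : c * (t - s + σ) ^ (-(p - 1)) * ‖x - y‖ ^ p ≤
          c * ‖x - y‖ ^ p / (t - s) ^ (p - 1) := by
        rw [div_eq_mul_inv, mul_right_comm]
        exact mul_le_mul_of_nonneg_left h1 (by positivity)
      linarith
    · intro r hr
      have hr0 := hg r hr.1.le
      have hder : HasDerivAt (fun r => c * (r - s + σ) ^ (-(p - 1)))
          (c * (-(p - 1) * (r - s + σ) ^ (-(p - 1) - 1))) r := by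
        have h1 : HasDerivAt (fun r => r - s + σ) 1 r := ((hasDerivAt_id r).sub_const s).add_const σ
        simpa using (h1.rpow_const (p := -(p - 1)) (Or.inl hr0.ne')).const_mul c
      rw [hder.deriv, show -(p - 1) - 1 = -p by ring, ← mul_assoc p c,
        Real.mul_rpow (by positivity) (Real.rpow_nonneg hr0.le _), ← Real.rpow_mul hr0.le,
        show -(p - 1) * q = -p by rw [neg_mul, hpq.sub_one_mul_conj]]
      have := mul_le_mul_of_nonneg_right hcκ (Real.rpow_nonneg hr0.le (-p))
      linarith
    · intro z
      rw [sub_self, zero_add]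
      have hn : 0 ≤ c * σ ^ (-(p - 1)) * ‖z - y‖ ^ p := by positivity
      rcases lt_or_ge (dist z y) d with hz | hz
      · linarith [hdy hz]
      · rw [dist_eq_norm] at hz
        have h1 : d ^ p ≤ ‖z - y‖ ^ p := Real.rpow_le_rpow hd.le hz hp0.le
        have h2 : c * σ ^ (-(p - 1)) * d ^ p ≤ c * σ ^ (-(p - 1)) * ‖z - y‖ ^ p :=
          mul_le_mul_of_nonneg_left h1 (by positivity)
        linarith [hM z s ⟨hs, hst.trans htT⟩]
  have ht : Tendsto (fun ε : ℝ =>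
      u y s + c * ‖x - y‖ ^ p / (t - s) ^ (p - 1) + η * (t - s) + ε * (1 + (t - s))) (𝓝[>] 0)
      (𝓝 (u y s + c * ‖x - y‖ ^ p / (t - s) ^ (p - 1) + η * (t - s) + 0 * (1 + (t - s)))) :=
    (Continuous.tendsto (by fun_prop) 0).mono_left nhdsWithin_le_nhds
  simpa using ge_of_tendsto ht (eventually_mem_nhdsWithin.mono fun ε hε => key ε hε)

/-- For `u ≥ -M` with `u_t + κ|Du|^q ≥ -η`: the value of a supersolution is bounded from below by
the Hopf–Lax infimum over an earlier time. -/
theorem IsViscositySupersolution.hopfLax_le {N : ℕ} {T : ℝ}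
    {H : EuclideanSpace ℝ (Fin N) → ℝ → EuclideanSpace ℝ (Fin N) → ℝ}
    {u : EuclideanSpace ℝ (Fin N) → ℝ → ℝ}
    (hu : IsViscositySupersolution (univ ×ˢ Ioo 0 T) H u)
    {p q κ η M c : ℝ} (hpq : p.HolderConjugate q)
    (hH : ∀ x, ∀ t ∈ Ioo 0 T, ∀ z, H x t z ≤ κ * ‖z‖ ^ q + η)
    (huc : ContinuousOn (fun w : EuclideanSpace ℝ (Fin N) × ℝ => u w.1 w.2) (univ ×ˢ Ioo 0 T))
    (hM : ∀ x, ∀ t ∈ Ioo 0 T, -M ≤ u x t)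
    (hc : 0 < c) (hcκ : κ * (p * c) ^ q ≤ (p - 1) * c)
    {s t a : ℝ} (hs : 0 < s) (hst : s < t) (htT : t < T) (x : EuclideanSpace ℝ (Fin N))
    (ha : ∀ y, a ≤ u y s + c * ‖y - x‖ ^ p / (t - s) ^ (p - 1)) :
    a - η * (t - s) ≤ u x t := by
  have hp := hpq.lt
  have hp0 := hpq.pos
  have hp1 : 0 < p - 1 := sub_pos.2 hp
  have key : ∀ ε > 0, ∀ r ∈ Ioo s t, a - (η + ε) * (t - s) - 2 * |η + ε| * (t - r) ≤ u x r := by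
    intro ε hε r hr
    obtain ⟨t₁, hrt₁, ht₁t⟩ := exists_between hr.2
    have hg : ∀ r', r' ≤ t₁ → 0 < t - r' := fun r' hr' => by linarith
    -- the barrier is concentrated at the point `(x, t)` as `r'` increases to `t`
    have h := hu.neg.le_radial_barrier hpq (κ := -κ) (η := η) (M := M)
      (fun x t ht z => by have := hH x t ht (-z); rw [norm_neg] at this; linarith)
      huc.neg (fun x t ht => by linarith [hM x t ht]) (s := s) (t₁ := t₁) (b := -a) (L := η + ε)
      (g := fun r' => c * (t - r') ^ (-(p - 1))) (g₀ := c * (t - s) ^ (-(p - 1))) (x₀ := x)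
      hs (ht₁t.trans htT) (by linarith)
      (mul_pos hc (Real.rpow_pos_of_pos (by linarith) _))
      (fun r' hr' => mul_le_mul_of_nonneg_left (Real.rpow_le_rpow_of_nonpos (hg r' hr'.2)
        (by linarith [hr'.1]) (by linarith)) hc.le)
      (fun r' hr' => contDiffAt_const.mul
        (ContDiffAt.rpow_const_of_ne (by fun_prop) (hg r' hr'.2).ne'))
      ?_ ?_ x r ⟨hr.1.le, hrt₁⟩
    · rw [sub_self, norm_zero, Real.zero_rpow hp0.ne', mul_zero] at h
      have h1 : (η + ε) * (r - s) ≤ (η + ε) * (t - s) + 2 * |η + ε| * (t - r) := by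
        nlinarith [neg_abs_le (η + ε), abs_nonneg (η + ε), hr.2]
      linarith
    · intro r' hr'
      have hr0 := hg r' hr'.2.le
      have hder : HasDerivAt (fun r' => c * (t - r') ^ (-(p - 1)))
          (c * ((p - 1) * (t - r') ^ (-(p - 1) - 1))) r' := by
        have h1 : HasDerivAt (fun r => t - r) (-1) r' := (hasDerivAt_id r').const_sub t
        exact ((h1.rpow_const (p := -(p - 1)) (Or.inl hr0.ne')).const_mul c).congr_deriv (by ring)
      rw [hder.deriv, show -(p - 1) - 1 = -p by ring, ← mul_assoc p c,
        Real.mul_rpow (by positivity) (Real.rpow_nonneg hr0.le _), ← Real.rpow_mul hr0.le,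
        show -(p - 1) * q = -p by rw [neg_mul, hpq.sub_one_mul_conj]]
      have := mul_le_mul_of_nonneg_right hcκ (Real.rpow_nonneg hr0.le (-p))
      linarith
    · intro z
      have h1 := ha z
      rw [div_eq_mul_inv, ← Real.rpow_neg (by linarith)] at h1
      have h2 : c * ‖z - x‖ ^ p * (t - s) ^ (-(p - 1)) =
        c * (t - s) ^ (-(p - 1)) * ‖z - x‖ ^ p := by ring
      linarith
  have hε : ∀ ε > 0, a - (η + ε) * (t - s) ≤ u x t := by
    intro ε hε
    have h1 : ContinuousAt (fun w : EuclideanSpace ℝ (Fin N) × ℝ => u w.1 w.2) (x, t) :=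
      huc.continuousAt (prod_mem_nhds univ_mem (Ioo_mem_nhds (hs.trans hst) htT))
    have h2 : ContinuousAt (fun r => u x r) t :=
      ContinuousAt.comp (f := fun r => (x, r)) h1 (Continuous.prodMk_right x).continuousAt
    have h3 : Tendsto (fun r => a - (η + ε) * (t - s) - 2 * |η + ε| * (t - r)) (𝓝[<] t)
        (𝓝 (a - (η + ε) * (t - s) - 2 * |η + ε| * (t - t))) :=
      (Continuous.tendsto (by fun_prop) t).mono_left nhdsWithin_le_nhds
    have h4 := le_of_tendsto_of_tendsto h3 (h2.tendsto.mono_left nhdsWithin_le_nhds)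
      (by filter_upwards [Ioo_mem_nhdsLT hst] with r hr using key ε hε r hr)
    simpa using h4
  have ht : Tendsto (fun ε : ℝ => a - (η + ε) * (t - s)) (𝓝[>] 0)
      (𝓝 (a - (η + 0) * (t - s))) :=
    (Continuous.tendsto (by fun_prop) 0).mono_left nhdsWithin_le_nhds
  simpa using le_of_tendsto ht (eventually_mem_nhdsWithin.mono fun ε h => hε ε h)

/-! ### Improvement of oscillation -/

/-- On each backward cylinder of radius `r`, height `h` and top time `t₀`, whatever its center, the
function `u` takes values in some interval of length `ω`. -/
def OscBound {X : Type*} [NormedAddCommGroup X] (u : X → ℝ → ℝ) (t₀ r h ω : ℝ) : Prop :=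
  ∀ x₀, ∃ m, ∀ x, ‖x - x₀‖ ≤ r → ∀ t ∈ Icc (t₀ - h) t₀, m ≤ u x t ∧ u x t ≤ m + ω

/-- A uniform oscillation bound at scale `r` yields at most linear growth at larger distances,
by chaining balls. -/
theorem OscBound.lower_bound {X : Type*} [NormedAddCommGroup X] [NormedSpace ℝ X] {u : X → ℝ → ℝ}
    {t₀ r h ω m s : ℝ} (hosc : OscBound u t₀ r h ω) (hr : 0 < r) (hω : 0 ≤ ω) {x₀ : X}
    (hs : s ∈ Icc (t₀ - h) t₀) (hm : ∀ x, ‖x - x₀‖ ≤ r → m ≤ u x s) (y : X) :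
    m - ‖y - x₀‖ / r * ω ≤ u y s := by
  have key : ∀ n : ℕ, ∀ y, ‖y - x₀‖ ≤ (n + 1) * r → m - n * ω ≤ u y s := by
    intro n
    induction n with
    | zero =>
      intro y hy
      simpa using hm y (by simpa using hy)
    | succ n ih =>
      intro y hy
      push_cast at hy ⊢
      have hn : (0 : ℝ) < n + 1 + 1 := by positivity
      set y' := y - ((n : ℝ) + 1 + 1)⁻¹ • (y - x₀) with hy'
      have h1 : ‖y' - y‖ ≤ r := by
        rw [hy', sub_sub_cancel_left, norm_neg, norm_smul, norm_inv, Real.norm_of_nonneg hn.le,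
          inv_mul_le_iff₀ hn]
        exact hy
      have h2 : ‖y' - x₀‖ ≤ (n + 1) * r := by
        have e : y' - x₀ = (((n : ℝ) + 1) / (n + 1 + 1)) • (y - x₀) := by
          have e2 : ((n : ℝ) + 1) / (n + 1 + 1) = 1 - ((n : ℝ) + 1 + 1)⁻¹ := by field_simp; ring
          rw [e2, sub_smul, one_smul, hy']
          abel
        rw [e, norm_smul, Real.norm_of_nonneg (by positivity), div_mul_eq_mul_div, div_le_iff₀ hn]
        nlinarith [n.cast_nonneg (α := ℝ)]
      obtain ⟨m', hm'⟩ := hosc y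
      have h3 := (hm' y (by simpa using hr.le) s hs).1
      have h4 := (hm' y' h1 s hs).2
      have h5 := ih y' h2
      linarith
  have hξ : 0 ≤ ‖y - x₀‖ / r := by positivity
  have h1 := key ⌊‖y - x₀‖ / r⌋₊ y (by
    rw [← div_le_iff₀ hr]
    exact (Nat.lt_floor_add_one _).le)
  have h2 := mul_le_mul_of_nonneg_right (Nat.floor_le hξ) hω
  linarith

/-- One step of the iteration, on cylinders with `rᵖ = Λ ω hᵖ⁻¹`, `Λ = 2ᵖ⁺¹ / c₂`, for which the
transport costs are comparable to the oscillation. Either `u` is at most the middle value somewhere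
near the center of the bottom of the cylinder, and `hA` lowers the upper bound, or it exceeds the
middle value there, and `hB` raises the lower bound. -/
theorem OscBound.step {X : Type*} [NormedAddCommGroup X] [NormedSpace ℝ X] {u : X → ℝ → ℝ}
    {p c₁ c₂ η T b t₀ r h ω r' h' : ℝ} (hp : 1 < p) (hc₁ : 0 < c₁) (hc₂ : 0 < c₂) (hη : 0 ≤ η)
    (hA : ∀ s t, 0 < s → s < t → t < T → ∀ x y,
      u x t ≤ u y s + c₁ * ‖x - y‖ ^ p / (t - s) ^ (p - 1) + η * (t - s))
    (hB : ∀ s t, 0 < s → s < t → t < T → ∀ x a,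
      (∀ y, a ≤ u y s + c₂ * ‖y - x‖ ^ p / (t - s) ^ (p - 1)) → a - η * (t - s) ≤ u x t)
    (hb : 0 < b) (hb4 : b ≤ 1 / 4)
    (hbΛ : c₁ * (2 * b) ^ p * 2 ^ (p - 1) * (2 ^ (p + 1) / c₂) ≤ 1 / 8)
    (hr : 0 < r) (hh : 0 < h) (hω : 0 < ω) (hth : 0 < t₀ - h) (htT : t₀ < T)
    (hscale : r ^ p = 2 ^ (p + 1) / c₂ * ω * h ^ (p - 1)) (hηh : η * h ≤ b ^ p / 2 * ω)
    (hr' : r' ≤ b / 2 * r) (hh' : h' ≤ h / 2) (hosc : OscBound u t₀ r h ω) :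
    OscBound u t₀ r' h' ((1 - b ^ p / 2) * ω) := by
  intro x₀
  obtain ⟨m, hm⟩ := hosc x₀
  have hp0 : 0 < p := by linarith
  have hs : t₀ - h ∈ Icc (t₀ - h) t₀ := ⟨le_rfl, by linarith⟩
  have hbp : 0 < b ^ p := Real.rpow_pos_of_pos hb p
  have hbp' : b ^ p ≤ 1 / 4 := by
    have := Real.rpow_le_rpow_of_exponent_ge hb (by linarith) hp.le
    rw [Real.rpow_one] at this
    linarith
  have hhp : 0 < h ^ (p - 1) := Real.rpow_pos_of_pos hh _
  have hbr : 0 < b * r := mul_pos hb hr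
  have hbr4 : b * r ≤ 1 / 4 * r := mul_le_mul_of_nonneg_right hb4 hr.le
  have hsub : ∀ x, ‖x - x₀‖ ≤ r' → ‖x - x₀‖ ≤ r := fun x hx => by nlinarith
  -- the cost of travelling a distance `2⁻¹ a r` within time at most `h`
  have hcost : ∀ a : ℝ, 0 ≤ a → c₂ * (a * r / 2) ^ p / h ^ (p - 1) = 2 * a ^ p * ω := by
    intro a ha
    rw [Real.div_rpow (by positivity) (by norm_num), Real.mul_rpow ha hr.le, hscale,
      Real.rpow_add (by norm_num), Real.rpow_one]
    field_simp
  by_cases hcase : ∃ y₀, ‖y₀ - x₀‖ ≤ b * r ∧ u y₀ (t₀ - h) ≤ m + ω / 2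
  · obtain ⟨y₀, hy₀, huy⟩ := hcase
    refine ⟨m, fun x hx t ht => ⟨(hm x (hsub x hx) t ⟨by linarith [ht.1], ht.2⟩).1, ?_⟩⟩
    have hst : h / 2 ≤ t - (t₀ - h) := by linarith [ht.1]
    have h1 := hA (t₀ - h) t hth (by linarith) (ht.2.trans_lt htT) x y₀
    have h2 : ‖x - y₀‖ ≤ 2 * b * r := by
      have := norm_sub_le_norm_sub_add_norm_sub x x₀ y₀
      rw [norm_sub_rev x₀ y₀] at this
      linarith
    have h3 : c₁ * ‖x - y₀‖ ^ p / (t - (t₀ - h)) ^ (p - 1) ≤ ω / 8 := by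
      calc c₁ * ‖x - y₀‖ ^ p / (t - (t₀ - h)) ^ (p - 1)
          ≤ c₁ * (2 * b * r) ^ p / (h / 2) ^ (p - 1) := by
            have h4 := Real.rpow_le_rpow (by positivity) hst (by linarith : 0 ≤ p - 1)
            have h5 := Real.rpow_le_rpow (norm_nonneg _) h2 hp0.le
            gcongr
        _ = (c₁ * (2 * b) ^ p * 2 ^ (p - 1) * (2 ^ (p + 1) / c₂)) * ω := by
            rw [Real.mul_rpow (by positivity) hr.le, hscale, Real.div_rpow hh.le (by norm_num)]
            field_simp
        _ ≤ 1 / 8 * ω := mul_le_mul_of_nonneg_right hbΛ hω.le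
        _ = ω / 8 := by ring
    have h4 : η * (t - (t₀ - h)) ≤ η * h := mul_le_mul_of_nonneg_left (by linarith [ht.2]) hη
    nlinarith
  · push Not at hcase
    refine ⟨m + b ^ p / 2 * ω, fun x hx t ht => ⟨?_, ?_⟩⟩
    · have hst : 0 < t - (t₀ - h) := by linarith [ht.1]
      have hst' : t - (t₀ - h) ≤ h := by linarith [ht.2]
      have h1 := hB (t₀ - h) t hth (by linarith) (ht.2.trans_lt htT) x (m + b ^ p * ω) ?_
      · have h4 : η * (t - (t₀ - h)) ≤ η * h := mul_le_mul_of_nonneg_left hst' hη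
        linarith
      intro y
      have hdist : ‖y - x₀‖ - b / 2 * r ≤ ‖y - x‖ := by
        have := norm_sub_le_norm_sub_add_norm_sub y x x₀
        linarith
      have hlow : ∀ a : ℝ, 0 ≤ a → a * r / 2 ≤ ‖y - x‖ →
          2 * a ^ p * ω ≤ c₂ * ‖y - x‖ ^ p / (t - (t₀ - h)) ^ (p - 1) := by
        intro a ha hay
        rw [← hcost a ha]
        have h4 := Real.rpow_le_rpow hst.le hst' (by linarith : 0 ≤ p - 1)
        have h5 := Real.rpow_le_rpow (by positivity) hay hp0.le
        have h6 := Real.rpow_pos_of_pos hst (p - 1)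
        gcongr
      rcases le_or_gt ‖y - x₀‖ (b * r) with h1 | h1
      · have h2 := hcase y h1
        have h3 : 0 ≤ c₂ * ‖y - x‖ ^ p / (t - (t₀ - h)) ^ (p - 1) := by positivity
        nlinarith
      rcases le_or_gt ‖y - x₀‖ r with h2 | h2
      · have h3 := (hm y h2 (t₀ - h) hs).1
        have h4 := hlow b hb.le (by linarith)
        have : 0 < b ^ p * ω := by positivity
        linarith
      · have hξ : 1 ≤ ‖y - x₀‖ / r := (one_le_div hr).2 h2.le
        have h3 := hosc.lower_bound hr hω.le hs (fun x hx => (hm x hx (t₀ - h) hs).1) y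
        have h4 := hlow (‖y - x₀‖ / r) (by positivity) (by
          rw [div_mul_cancel₀ _ hr.ne']
          nlinarith)
        have h5 : ‖y - x₀‖ / r ≤ (‖y - x₀‖ / r) ^ p := Real.self_le_rpow_of_one_le hξ hp.le
        have h6 := mul_le_mul_of_nonneg_right h5 hω.le
        nlinarith
    · have := (hm x (hsub x hx) t ⟨by linarith [ht.1], ht.2⟩).2
      linarith

/-- Geometric decay of the oscillation along cylinders shrinking by fixed ratios. -/
theorem OscBound.iterate {X : Type*} [NormedAddCommGroup X] [NormedSpace ℝ X] {u : X → ℝ → ℝ}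
    {p c₁ c₂ η T b t₀ r h ω ρ μ : ℝ} (hp : 1 < p) (hc₁ : 0 < c₁) (hc₂ : 0 < c₂) (hη : 0 ≤ η)
    (hA : ∀ s t, 0 < s → s < t → t < T → ∀ x y,
      u x t ≤ u y s + c₁ * ‖x - y‖ ^ p / (t - s) ^ (p - 1) + η * (t - s))
    (hB : ∀ s t, 0 < s → s < t → t < T → ∀ x a,
      (∀ y, a ≤ u y s + c₂ * ‖y - x‖ ^ p / (t - s) ^ (p - 1)) → a - η * (t - s) ≤ u x t)
    (hb : 0 < b) (hb4 : b ≤ 1 / 4)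
    (hbΛ : c₁ * (2 * b) ^ p * 2 ^ (p - 1) * (2 ^ (p + 1) / c₂) ≤ 1 / 8)
    (hρ : 0 < ρ) (hρb : ρ ≤ b / 2) (hμ : 0 < μ) (hμ2 : μ ≤ 1 / 2)
    (hρμ : ρ ^ p = (1 - b ^ p / 2) * μ ^ (p - 1))
    (hr : 0 < r) (hh : 0 < h) (hω : 0 < ω) (hth : 0 < t₀ - h) (htT : t₀ < T)
    (hscale : r ^ p = 2 ^ (p + 1) / c₂ * ω * h ^ (p - 1)) (hηh : η * h ≤ b ^ p / 2 * ω)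
    (hosc : OscBound u t₀ r h ω) (k : ℕ) :
    OscBound u t₀ (r * ρ ^ k) (h * μ ^ k) (ω * (1 - b ^ p / 2) ^ k) := by
  have hbp : 0 < b ^ p := Real.rpow_pos_of_pos hb p
  have hbp' : b ^ p ≤ 1 / 4 := by
    have := Real.rpow_le_rpow_of_exponent_ge hb (by linarith) hp.le
    rw [Real.rpow_one] at this
    linarith
  set l := 1 - b ^ p / 2 with hl
  have hl2 : 1 / 2 ≤ l := by linarith
  have hl0 : 0 < l := by linarith
  induction k with
  | zero => simpa using hosc
  | succ k ih =>
    have hμk : μ ^ k ≤ 1 := pow_le_one₀ hμ.le (by linarith)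
    have hμl : μ ^ k ≤ l ^ k := pow_le_pow_left₀ hμ.le (by linarith) k
    have h1 := ih.step (r' := r * ρ ^ (k + 1)) (h' := h * μ ^ (k + 1)) hp hc₁ hc₂ hη hA hB hb hb4
      hbΛ (by positivity) (by positivity) (by positivity) (by nlinarith) htT ?_ ?_ ?_ ?_
    · rw [← hl] at h1
      convert h1 using 1
      ring
    · have e : (ρ ^ k) ^ p = l ^ k * (μ ^ k) ^ (p - 1) := by
        rw [← Real.rpow_pow_comm hρ.le, hρμ, mul_pow, Real.rpow_pow_comm hμ.le]
      rw [Real.mul_rpow hr.le (by positivity), Real.mul_rpow hh.le (by positivity), hscale, e]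
      ring
    · have h2 := mul_le_mul_of_nonneg_right hηh (by positivity : 0 ≤ μ ^ k)
      have h3 := mul_le_mul_of_nonneg_left hμl (by positivity : 0 ≤ b ^ p / 2 * ω)
      linarith
    · have := mul_le_mul_of_nonneg_left hρb (by positivity : 0 ≤ r * ρ ^ k)
      rw [pow_succ]
      linarith
    · have := mul_le_mul_of_nonneg_left hμ2 (by positivity : 0 ≤ h * μ ^ k)
      rw [pow_succ]
      linarith

/-! ### From geometric decay to a Hölder bound -/

/-- The constant for which the Hopf–Lax kernel `c ‖x‖ᵖ / tᵖ⁻¹` solves `w_t + κ|Dw|^q = 0`. -/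
theorem exists_hopfLax_const {p q κ : ℝ} (hpq : p.HolderConjugate q) (hκ : 0 < κ) :
    ∃ c : ℝ, 0 < c ∧ κ * (p * c) ^ q = (p - 1) * c := by
  have hp := hpq.pos
  have hp1 : 0 < p - 1 := sub_pos.2 hpq.lt
  have hq1 : 0 < q - 1 := sub_pos.2 hpq.symm.lt
  have hpow : 0 < p ^ q := Real.rpow_pos_of_pos hp q
  set K := (p - 1) / (κ * p ^ q) with hK
  have hK0 : 0 < K := by positivity
  refine ⟨K ^ (q - 1)⁻¹, by positivity, ?_⟩
  have h1 : (K ^ (q - 1)⁻¹) ^ q = K * K ^ (q - 1)⁻¹ := by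
    rw [show q = (q - 1) + 1 by ring, Real.rpow_add (by positivity), Real.rpow_one,
      add_sub_cancel_right, ← Real.rpow_mul hK0.le, inv_mul_cancel₀ hq1.ne', Real.rpow_one]
  rw [Real.mul_rpow hp.le (by positivity), h1, hK]
  field_simp

/-- Admissible ratios for the iteration; they depend on `p`, `c₁` and `c₂` only. -/
theorem exists_iteration_ratios {p c₁ c₂ : ℝ} (hp : 1 < p) :
    ∃ b ρ μ : ℝ, 0 < b ∧ b ≤ 1 / 4 ∧
      c₁ * (2 * b) ^ p * 2 ^ (p - 1) * (2 ^ (p + 1) / c₂) ≤ 1 / 8 ∧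
      0 < ρ ∧ ρ ≤ b / 2 ∧ 0 < μ ∧ μ ≤ 1 / 2 ∧ ρ ^ p = (1 - b ^ p / 2) * μ ^ (p - 1) := by
  have hp0 : 0 < p := by linarith
  have hb : Tendsto (fun b : ℝ => c₁ * (2 * b) ^ p * 2 ^ (p - 1) * (2 ^ (p + 1) / c₂)) (𝓝[>] 0)
      (𝓝 (c₁ * (2 * 0) ^ p * 2 ^ (p - 1) * (2 ^ (p + 1) / c₂))) := by
    have h : Continuous fun b : ℝ => (2 * b) ^ p :=
      (continuous_const.mul continuous_id).rpow_const fun _ => Or.inr hp0.le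
    exact (Continuous.tendsto (by fun_prop) 0).mono_left nhdsWithin_le_nhds
  rw [mul_zero, Real.zero_rpow hp0.ne', mul_zero, zero_mul, zero_mul] at hb
  obtain ⟨b, hb1, hb0, hb4⟩ := ((hb.eventually_le_const (by norm_num : (0 : ℝ) < 1 / 8)).and
    (Ioc_mem_nhdsGT (by norm_num : (0 : ℝ) < 1 / 4))).exists
  have hl : 0 < 1 - b ^ p / 2 := by
    have := Real.rpow_le_one hb0.le (by linarith) hp0.le
    linarith
  have hμ : Tendsto (fun μ : ℝ => ((1 - b ^ p / 2) * μ ^ (p - 1)) ^ p⁻¹) (𝓝[>] 0)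
      (𝓝 (((1 - b ^ p / 2) * 0 ^ (p - 1)) ^ p⁻¹)) := by
    have h : Continuous fun μ : ℝ => μ ^ (p - 1) :=
      continuous_id.rpow_const fun _ => Or.inr (by linarith)
    have h' : Continuous fun μ : ℝ => ((1 - b ^ p / 2) * μ ^ (p - 1)) ^ p⁻¹ :=
      (continuous_const.mul h).rpow_const fun _ => Or.inr (by positivity)
    exact (h'.tendsto 0).mono_left nhdsWithin_le_nhds
  rw [Real.zero_rpow (by linarith), mul_zero, Real.zero_rpow (by positivity)] at hμ
  obtain ⟨μ, hμ1, hμ0, hμ2⟩ := ((hμ.eventually_le_const (by linarith : 0 < b / 2)).and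
    (Ioc_mem_nhdsGT (by norm_num : (0 : ℝ) < 1 / 2))).exists
  have hμp : 0 < μ ^ (p - 1) := Real.rpow_pos_of_pos hμ0 _
  exact ⟨b, _, μ, hb0, hb4, hb1, by positivity, hμ1, hμ0, hμ2,
    Real.rpow_inv_rpow (by positivity) hp0.ne'⟩

/-- Both Hölder exponents tend to `0` as `θ` decreases to `p`, so any geometric decay is fast enough
for some `θ > p`. -/
theorem exists_theta {p l ρ μ : ℝ} (hp : 1 < p) (hl : l < 1) (hρ : 0 < ρ) (hμ : 0 < μ) :
    ∃ θ, p < θ ∧ l ≤ ρ ^ ((θ - p) / (θ - 1)) ∧ l ≤ μ ^ ((θ - p) / θ) := by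
  have h1 : Tendsto (fun θ : ℝ => ρ ^ ((θ - p) / (θ - 1))) (𝓝[>] p) (𝓝 1) := by
    have h : ContinuousAt (fun θ : ℝ => ρ ^ ((θ - p) / (θ - 1))) p :=
      ContinuousAt.rpow continuousAt_const (ContinuousAt.div (by fun_prop) (by fun_prop)
        (by linarith)) (Or.inl hρ.ne')
    simpa using h.tendsto.mono_left nhdsWithin_le_nhds
  have h2 : Tendsto (fun θ : ℝ => μ ^ ((θ - p) / θ)) (𝓝[>] p) (𝓝 1) := by
    have h : ContinuousAt (fun θ : ℝ => μ ^ ((θ - p) / θ)) p :=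
      ContinuousAt.rpow continuousAt_const (ContinuousAt.div (by fun_prop) (by fun_prop)
        (by linarith)) (Or.inl hμ.ne')
    simpa using h.tendsto.mono_left nhdsWithin_le_nhds
  obtain ⟨θ, h3, h4, h5⟩ := ((h1.eventually_const_le hl).and
    ((h2.eventually_const_le hl).and self_mem_nhdsWithin)).exists
  exact ⟨θ, h5, h3, h4⟩

/-- A quantity bounded by `ω lᵏ` whenever `d ≤ r ρᵏ` and `e ≤ h μᵏ` is controlled by powers of `d`
and `e`. -/
theorem le_rpow_add_rpow_of_decay {D ω l ρ μ r h α β d e : ℝ} (hω : 0 < ω) (hl : 0 < l)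
    (hl1 : l < 1) (hρ : 0 < ρ) (hμ : 0 < μ) (hr : 0 < r) (hh : 0 < h) (hα : 0 < α) (hβ : 0 < β)
    (hlρ : l ≤ ρ ^ α) (hlμ : l ≤ μ ^ β) (hd : 0 ≤ d) (he : 0 ≤ e) (hD : D ≤ ω)
    (hdec : ∀ k : ℕ, d ≤ r * ρ ^ k → e ≤ h * μ ^ k → D ≤ ω * l ^ k) :
    D ≤ ω / l * ((d / r) ^ α + (e / h) ^ β) := by
  have hdr : 0 ≤ (d / r) ^ α := by positivity
  have heh : 0 ≤ (e / h) ^ β := by positivity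
  set S := (d / r) ^ α + (e / h) ^ β with hS
  have hS0 : 0 ≤ S := add_nonneg hdr heh
  have key : ∀ k : ℕ, S ≤ l ^ k → D ≤ ω * l ^ k := by
    intro k hk
    refine hdec k ?_ ?_
    · have h1 : (d / r) ^ α ≤ (ρ ^ k) ^ α := by
        rw [← Real.rpow_pow_comm hρ.le]
        exact ((le_add_of_nonneg_right heh).trans hk).trans (pow_le_pow_left₀ hl.le hlρ k)
      rw [Real.rpow_le_rpow_iff (by positivity) (by positivity) hα, div_le_iff₀ hr] at h1
      linarith
    · have h1 : (e / h) ^ β ≤ (μ ^ k) ^ β := by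
        rw [← Real.rpow_pow_comm hμ.le]
        exact ((le_add_of_nonneg_left hdr).trans hk).trans (pow_le_pow_left₀ hl.le hlμ k)
      rw [Real.rpow_le_rpow_iff (by positivity) (by positivity) hβ, div_le_iff₀ hh] at h1
      linarith
  rcases hS0.eq_or_lt with h0 | h0
  · rw [← h0, mul_zero]
    have ht : Tendsto (fun k : ℕ => ω * l ^ k) atTop (𝓝 (ω * 0)) :=
      (tendsto_pow_atTop_nhds_zero_of_lt_one hl.le hl1).const_mul ω
    rw [mul_zero] at ht
    exact ge_of_tendsto' ht fun k => key k (by rw [← h0]; positivity)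
  rw [div_mul_eq_mul_div, le_div_iff₀ hl]
  rcases le_or_gt S 1 with h1 | h1
  · obtain ⟨k, hk, hk'⟩ := exists_nat_pow_near_of_lt_one h0 h1 hl hl1
    calc D * l ≤ ω * l ^ k * l := mul_le_mul_of_nonneg_right (key k hk') hl.le
      _ = ω * l ^ (k + 1) := by ring
      _ ≤ ω * S := mul_le_mul_of_nonneg_left hk.le hω.le
  · nlinarith

/-- The Hölder bound away from the final time. -/
theorem abs_sub_le_of_hopfLax {X : Type*} [NormedAddCommGroup X] [NormedSpace ℝ X] {u : X → ℝ → ℝ}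
    {p c₁ c₂ η T M b h ω r ρ μ α β τ : ℝ} (hp : 1 < p) (hc₁ : 0 < c₁) (hc₂ : 0 < c₂) (hη : 0 ≤ η)
    (hA : ∀ s t, 0 < s → s < t → t < T → ∀ x y,
      u x t ≤ u y s + c₁ * ‖x - y‖ ^ p / (t - s) ^ (p - 1) + η * (t - s))
    (hB : ∀ s t, 0 < s → s < t → t < T → ∀ x a,
      (∀ y, a ≤ u y s + c₂ * ‖y - x‖ ^ p / (t - s) ^ (p - 1)) → a - η * (t - s) ≤ u x t)
    (hb : 0 < b) (hb4 : b ≤ 1 / 4)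
    (hbΛ : c₁ * (2 * b) ^ p * 2 ^ (p - 1) * (2 ^ (p + 1) / c₂) ≤ 1 / 8)
    (hρ : 0 < ρ) (hρb : ρ ≤ b / 2) (hμ : 0 < μ) (hμ2 : μ ≤ 1 / 2)
    (hρμ : ρ ^ p = (1 - b ^ p / 2) * μ ^ (p - 1))
    (hr : 0 < r) (hh : 0 < h) (hω : 0 < ω) (hhτ : h < τ)
    (hscale : r ^ p = 2 ^ (p + 1) / c₂ * ω * h ^ (p - 1)) (hηh : η * h ≤ b ^ p / 2 * ω)
    (hα : 0 < α) (hβ : 0 < β) (hlρ : 1 - b ^ p / 2 ≤ ρ ^ α) (hlμ : 1 - b ^ p / 2 ≤ μ ^ β)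
    (hM : ∀ x, ∀ t ∈ Ioo 0 T, |u x t| ≤ M) (hMω : 2 * M ≤ ω)
    (x y : X) {t s : ℝ} (ht : t ∈ Ico τ T) (hs : s ∈ Ico τ T) :
    |u x t - u y s| ≤
      ω / (1 - b ^ p / 2) * ((‖x - y‖ / r) ^ α + (|t - s| / h) ^ β) := by
  have hbp : 0 < b ^ p := Real.rpow_pos_of_pos hb p
  have hbp' : b ^ p ≤ 1 := Real.rpow_le_one hb.le (by linarith) (by linarith)
  have htT : max t s < T := max_lt ht.2 hs.2
  have hτ : τ ≤ max t s := ht.1.trans (le_max_left _ _)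
  have hosc : OscBound u (max t s) r h ω := by
    refine fun x₀ => ⟨-M, fun z _ r' hr' => ?_⟩
    have h1 := abs_le.1 (hM z r' ⟨by linarith [hr'.1], hr'.2.trans_lt htT⟩)
    exact ⟨h1.1, by linarith [h1.2]⟩
  have ht0 := abs_le.1 (hM x t ⟨by linarith [ht.1], ht.2⟩)
  have hs0 := abs_le.1 (hM y s ⟨by linarith [hs.1], hs.2⟩)
  refine le_rpow_add_rpow_of_decay hω (by linarith) (by linarith) hρ hμ hr hh hα hβ hlρ hlμ
    (norm_nonneg _) (abs_nonneg _) (abs_le.2 ⟨by linarith, by linarith⟩) fun k hd he => ?_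
  obtain ⟨m, hm⟩ := hosc.iterate hp hc₁ hc₂ hη hA hB hb hb4 hbΛ hρ hρb hμ hμ2 hρμ hr hh hω
    (by linarith) htT hscale hηh k x
  have he' := abs_le.1 he
  have h1 := hm x (by rw [sub_self, norm_zero]; positivity) t
    ⟨by rcases max_cases t s with h | h <;> linarith [abs_nonneg (t - s)], le_max_left _ _⟩
  have h2 := hm y (by rwa [norm_sub_rev]) s
    ⟨by rcases max_cases t s with h | h <;> linarith [abs_nonneg (t - s)], le_max_right _ _⟩
  exact abs_le.2 ⟨by linarith [h1.1, h2.2], by linarith [h1.2, h2.1]⟩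

theorem theorem4p1 (N : ℕ) (p q δ ηplus ηminus M : ℝ) (hq : 1 < q) (hpq : 1 / p + 1 / q = 1)
    (hδ : 1 < δ) (hηplus : 0 ≤ ηplus) (hηminus : 0 ≤ ηminus) (hM : 0 < M) :
    ∃ θ : ℝ, p < θ ∧ ∀ τ : ℝ, 0 < τ → ∃ C : ℝ, 0 < C ∧
      ∀ (T : ℝ), τ ≤ T →
      ∀ (H : EuclideanSpace ℝ (Fin N) → ℝ → EuclideanSpace ℝ (Fin N) → ℝ)
        (u : EuclideanSpace ℝ (Fin N) → ℝ → ℝ),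
        ContinuousOn
          (fun w : EuclideanSpace ℝ (Fin N) × ℝ × EuclideanSpace ℝ (Fin N) => H w.1 w.2.1 w.2.2)
          {w | w.2.1 ∈ Set.Ioo 0 T} →
        (∀ x, ∀ t ∈ Set.Ioo 0 T, ∀ z,
          1 / δ * ‖z‖ ^ q - ηminus ≤ H x t z ∧ H x t z ≤ δ * ‖z‖ ^ q + ηplus) →
        ContinuousOn (fun w : EuclideanSpace ℝ (Fin N) × ℝ => u w.1 w.2)
          (Set.univ ×ˢ Set.Icc 0 T) →
        IsViscositySolution (Set.univ ×ˢ Set.Ioo 0 T) H u →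
        (∀ x, ∀ t ∈ Set.Ioo 0 T, |u x t| ≤ M) →
        ∀ x y, ∀ t ∈ Set.Icc τ T, ∀ s ∈ Set.Icc τ T,
          |u x t - u y s| ≤
            C * (‖x - y‖ ^ ((θ - p) / (θ - 1)) + |t - s| ^ ((θ - p) / θ)) := by
  have hc : p.HolderConjugate q := by
    refine (Real.holderConjugate_iff.2 ⟨hq, ?_⟩).symm
    rw [one_div, one_div] at hpq
    linarith
  have hp := hc.lt
  obtain ⟨c₁, hc₁, hcκ₁⟩ := exists_hopfLax_const hc (κ := 1 / δ) (by positivity)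
  obtain ⟨c₂, hc₂, hcκ₂⟩ := exists_hopfLax_const hc (κ := δ) (by positivity)
  obtain ⟨b, ρ, μ, hb, hb4, hbΛ, hρ, hρb, hμ, hμ2, hρμ⟩ :=
    exists_iteration_ratios (c₁ := c₁) (c₂ := c₂) hp
  have hbp : 0 < b ^ p := Real.rpow_pos_of_pos hb p
  have hbp' : b ^ p ≤ 1 := Real.rpow_le_one hb.le (by linarith) (by linarith)
  have hl0 : 0 < 1 - b ^ p / 2 := by linarith
  obtain ⟨θ, hθ, hlρ, hlμ⟩ := exists_theta (l := 1 - b ^ p / 2) hp (by linarith) hρ hμ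
  refine ⟨θ, hθ, fun τ hτ => ?_⟩
  set α := (θ - p) / (θ - 1) with hα'
  set β := (θ - p) / θ with hβ'
  have hα : 0 < α := div_pos (by linarith) (by linarith)
  have hβ : 0 < β := div_pos (by linarith) (by linarith)
  set η := ηplus + ηminus with hη'
  have hη : 0 ≤ η := add_nonneg hηplus hηminus
  set h := τ / 4 with hh'
  have hh : 0 < h := by positivity
  -- the second summand makes the drift `η h` negligible on the initial cylinder
  set ω := 2 * M + η * h / (b ^ p / 2) with hω'
  have hω : 0 < ω := by positivity
  have hηh : η * h ≤ b ^ p / 2 * ω := by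
    rw [hω', mul_add, mul_div_cancel₀ _ (by positivity)]
    have : 0 < b ^ p / 2 * (2 * M) := by positivity
    linarith
  set r := (2 ^ (p + 1) / c₂ * ω * h ^ (p - 1)) ^ p⁻¹ with hr'
  have hr : 0 < r := by positivity
  have hscale : r ^ p = 2 ^ (p + 1) / c₂ * ω * h ^ (p - 1) :=
    Real.rpow_inv_rpow (by positivity) hc.pos.ne'
  set K := ω / (1 - b ^ p / 2) with hK'
  have hK : 0 < K := div_pos hω hl0
  refine ⟨K * ((r ^ α)⁻¹ + (h ^ β)⁻¹), by positivity, fun T hT H u _ hH huc hu huM => ?_⟩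
  have huc' : ContinuousOn (fun w : EuclideanSpace ℝ (Fin N) × ℝ => u w.1 w.2)
      (univ ×ˢ Ioo 0 T) := huc.mono (prod_mono subset_rfl Ioo_subset_Icc_self)
  have hA : ∀ s t, 0 < s → s < t → t < T → ∀ x y,
      u x t ≤ u y s + c₁ * ‖x - y‖ ^ p / (t - s) ^ (p - 1) + η * (t - s) :=
    fun s t hs hst ht x y => hu.1.le_hopfLax hc (κ := 1 / δ)
      (fun x t ht z => by linarith [(hH x t ht z).1]) huc'
      (fun x t ht => (abs_le.1 (huM x t ht)).2) hc₁ hcκ₁.ge hs hst ht x y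
  have hB : ∀ s t, 0 < s → s < t → t < T → ∀ x a,
      (∀ y, a ≤ u y s + c₂ * ‖y - x‖ ^ p / (t - s) ^ (p - 1)) → a - η * (t - s) ≤ u x t :=
    fun s t hs hst ht x a ha => hu.2.hopfLax_le hc (κ := δ)
      (fun x t ht z => by linarith [(hH x t ht z).2]) huc'
      (fun x t ht => (abs_le.1 (huM x t ht)).1) hc₂ hcκ₂.le hs hst ht x ha
  have hmain : ∀ x y, ∀ t ∈ Ico (τ / 2) T, ∀ s ∈ Ico (τ / 2) T,
      |u x t - u y s| ≤ K * ((r ^ α)⁻¹ + (h ^ β)⁻¹) * (‖x - y‖ ^ α + |t - s| ^ β) := by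
    intro x y t ht s hs
    refine (abs_sub_le_of_hopfLax hp hc₁ hc₂ hη hA hB hb hb4 hbΛ hρ hρb hμ hμ2 hρμ hr hh hω
      (by linarith) hscale hηh hα hβ hlρ hlμ huM (by rw [hω']; simp; positivity)
      x y ht hs).trans ?_
    rw [mul_assoc]
    refine mul_le_mul_of_nonneg_left ?_ hK.le
    rw [Real.div_rpow (norm_nonneg _) hr.le, Real.div_rpow (abs_nonneg _) hh.le, div_eq_inv_mul,
      div_eq_inv_mul]
    have h1 : 0 ≤ (r ^ α)⁻¹ * |t - s| ^ β := by positivity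
    have h2 : 0 ≤ (h ^ β)⁻¹ * ‖x - y‖ ^ α := by positivity
    linarith
  intro x y t ht s hs
  -- the final time is reached by shifting both times back by `ε`
  have hlim : ∀ x, ∀ t ∈ Icc τ T, Tendsto (fun ε => u x (t - ε)) (𝓝[>] 0) (𝓝 (u x t)) := by
    intro x t ht
    have h1 : ContinuousWithinAt (fun w : EuclideanSpace ℝ (Fin N) × ℝ => u w.1 w.2)
        (univ ×ˢ Icc 0 T) (x, t) := huc _ ⟨mem_univ _, hτ.le.trans ht.1, ht.2⟩
    refine Tendsto.comp (f := fun ε : ℝ => (x, t - ε)) h1 (tendsto_nhdsWithin_iff.2 ⟨?_, ?_⟩)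
    · have : Continuous fun ε : ℝ => (x, t - ε) := by fun_prop
      simpa using (this.tendsto 0).mono_left nhdsWithin_le_nhds
    · filter_upwards [Ioo_mem_nhdsGT hτ] with ε hε
      exact ⟨mem_univ _, by linarith [ht.1, hε.2], by linarith [ht.2, hε.1]⟩
  refine le_of_tendsto ((hlim x t ht).sub (hlim y s hs)).abs ?_
  filter_upwards [Ioo_mem_nhdsGT (half_pos hτ)] with ε hε
  have := hmain x y (t - ε) ⟨by linarith [ht.1, hε.2], by linarith [ht.2, hε.1]⟩
    (s - ε) ⟨by linarith [hs.1, hε.2], by linarith [hs.2, hε.1]⟩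
  rwa [sub_sub_sub_cancel_right] at this
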